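/- Let $A\in\mathbb R^{m\times n}$, $D\in\mathbb R^{n\times p}$, $b_0\in\mathbb R^m$, and consider the problem $$(AP)\qquad \min_{x\in\mathbb R^n}\ \|D^Tx\|_1\quad\text{s.t.}\quad Ax=b_0 .$$ Call a feasible point $x_0$ a sharp solution of $(AP)$ if there are $\kappa,\delta>0$ such that $\|D^Tx\|_1-\|D^Tx_0\|_1\ge\kappa\|x-x_0\|$ for all $x$ with $Ax=b_0$ and $\|x-x_0\|\le\delta$, where $\|\cdot\|$ is the Euclidean norm. Let $x_0$ be a feasible point, let $I=\operatorname{supp}(D^Tx_0)=\{i:(D^Tx_0)_i\neq0\}$, $I^c=\{1,\dots,p\}\setminus I$, and let $D^T_{I^c}$ be the submatrix of $D^T$ formed by the rows with index in $I^c$. Consider the two conditions 1. $\operatorname{Ker}A\cap\operatorname{Ker}(D^T_{I^c})=\{0\}$; 2. there are $y_0\in\mathbb R^m$ and $u\in\mathbb R^p$ with $A^Ty_0=Du$, $u_I=\operatorname{sign}(D^Tx_0)_I$ and $\|u_{I^c}\|_\infty<1$ (the norm being $0$ if $I^c=\emptyset$). Then $x_0$ is the unique solution of $(AP)$ if and only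 if conditions 1 and 2 both hold, and $x_0$ is a sharp solution of $(AP)$ if and only if conditions 1 and 2 both hold. In particular, $x_0$ is the unique solution if and only if it is a sharp solution. -/

import Mathlib

open scoped Matrix

/-- The `ℓ₁` norm of a real vector. -/
def l1Norm {p : ℕ} (z : Fin p → ℝ) : ℝ := ∑ i, |z i|

/-- The Euclidean norm of a real vector. -/
noncomputable def euclNorm {n : ℕ} (x : Fin n → ℝ) : ℝ := ‖(WithLp.toLp 2 x : EuclideanSpace ℝ (Fin n))‖

/-- The feasible set `{x : A x = b}`. -/
def feasibleSet {m n : ℕ} (A : Matrix (Fin m) (Fin n) ℝ) (b : Fin m → ℝ) : Set (Fin n → ℝ) :=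
  {x | A *ᵥ x = b}

/-- The analysis `ℓ₁` objective `x ↦ ‖Dᵀ x‖₁`. -/
def analysisL1 {n p : ℕ} (D : Matrix (Fin n) (Fin p) ℝ) (x : Fin n → ℝ) : ℝ :=
  l1Norm (Dᵀ *ᵥ x)

/-- The set of solutions (global minimizers) of `min f(x)` subject to `x ∈ X`. -/
def solutionSet {n : ℕ} (f : (Fin n → ℝ) → ℝ) (X : Set (Fin n → ℝ)) : Set (Fin n → ℝ) :=
  {x | x ∈ X ∧ ∀ x' ∈ X, f x ≤ f x'}

/-- `x₀` is the unique solution of `min f(x)` subject to `x ∈ X`. -/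
def IsUniqueSolution {n : ℕ} (f : (Fin n → ℝ) → ℝ) (X : Set (Fin n → ℝ)) (x₀ : Fin n → ℝ) : Prop :=
  solutionSet f X = {x₀}

/-- `x₀` is a sharp solution of `min f(x)` subject to `x ∈ X`: it is feasible and a sharp minimizer
of `f + I_X`, where `I_X` is the indicator function (`0` on `X`, `+∞` off `X`). The defining
inequality is automatic at points off `X`, so it is required on `X` only. -/
def IsSharpSolution {n : ℕ} (f : (Fin n → ℝ) → ℝ) (X : Set (Fin n → ℝ)) (x₀ : Fin n → ℝ) : Prop :=
  x₀ ∈ X ∧ ∃ κ > 0, ∃ δ > 0, ∀ x ∈ X, euclNorm (x - x₀) ≤ δ →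
    f x - f x₀ ≥ κ * euclNorm (x - x₀)

/-- The support of a real vector. -/
def suppSet {p : ℕ} (z : Fin p → ℝ) : Set (Fin p) := {i | z i ≠ 0}

/-- The submatrix of `M` formed by the rows with index in `S`. -/
def rowSubmatrix {p n : ℕ} (M : Matrix (Fin p) (Fin n) ℝ) (S : Set (Fin p)) : Matrix S (Fin n) ℝ :=
  M.submatrix Subtype.val id

/-- `Ker A ∩ Ker (Dᵀ_{Iᶜ}) = {0}` with `I = supp (Dᵀ x₀)`. -/
def KernelCondition {m n p : ℕ} (A : Matrix (Fin m) (Fin n) ℝ) (D : Matrix (Fin n) (Fin p) ℝ)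
    (x₀ : Fin n → ℝ) : Prop :=
  LinearMap.ker A.mulVecLin ⊓
    LinearMap.ker (rowSubmatrix Dᵀ (suppSet (Dᵀ *ᵥ x₀))ᶜ).mulVecLin = ⊥

open scoped Classical in
/-- There are `y₀`, `u` with `Aᵀ y₀ = D u`, `u_I = sign (Dᵀ x₀)_I` and `‖u_{Iᶜ}‖_∞ < 1`, where
`I = supp (Dᵀ x₀)`. The norm of the function on `Iᶜ` is Mathlib's supremum norm, which is `0` if
`Iᶜ` is empty. -/
def DualCertificate {m n p : ℕ} (A : Matrix (Fin m) (Fin n) ℝ) (D : Matrix (Fin n) (Fin p) ℝ)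
    (x₀ : Fin n → ℝ) : Prop :=
  ∃ (y₀ : Fin m → ℝ) (u : Fin p → ℝ), Aᵀ *ᵥ y₀ = D *ᵥ u ∧
    (∀ i ∈ suppSet (Dᵀ *ᵥ x₀), u i = Real.sign ((Dᵀ *ᵥ x₀) i)) ∧
    ‖fun i : ↥((suppSet (Dᵀ *ᵥ x₀))ᶜ) => u i‖ < 1

/-- Support-type function of the box `{u | uᵢ = sign aᵢ if aᵢ ≠ 0, |uᵢ| ≤ c otherwise}`. For `c = 1`
it is the directional derivative of the `ℓ₁` norm at `a`. -/
noncomputable def l1Dir {p : ℕ} (c : ℝ) (a z : Fin p → ℝ) : ℝ :=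
  ∑ i, if a i = 0 then c * |z i| else Real.sign (a i) * z i

theorem abs_add_sign_mul_le {a : ℝ} (ha : a ≠ 0) (b : ℝ) :
    |a| + Real.sign a * b ≤ |a + b| := by
  rcases lt_or_gt_of_ne ha with h | h
  · rw [Real.sign_of_neg h, abs_of_neg h]
    linarith [neg_le_abs (a + b)]
  · rw [Real.sign_of_pos h, abs_of_pos h]
    linarith [le_abs_self (a + b)]

theorem abs_add_eq_of_abs_lt {a b : ℝ} (h : |b| < |a|) :
    |a + b| = |a| + Real.sign a * b := by
  have hb := abs_lt.1 h
  rcases lt_trichotomy a 0 with ha | ha | ha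
  · rw [abs_of_neg ha] at hb ⊢
    rw [Real.sign_of_neg ha, abs_of_neg (by linarith)]
    ring
  · subst ha
    linarith [abs_nonneg b, abs_zero (α := ℝ)]
  · rw [abs_of_pos ha] at hb ⊢
    rw [Real.sign_of_pos ha, abs_of_pos (by linarith)]
    ring

theorem l1Norm_add_l1Dir_le {p : ℕ} (a z : Fin p → ℝ) :
    l1Norm a + l1Dir 1 a z ≤ l1Norm (a + z) := by
  unfold l1Norm l1Dir
  rw [← Finset.sum_add_distrib]
  refine Finset.sum_le_sum fun i _ => ?_
  split_ifs with h
  · simp [h]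
  · exact abs_add_sign_mul_le h _

theorem eventually_l1Norm_add_smul {p : ℕ} (a z : Fin p → ℝ) :
    ∀ᶠ t : ℝ in nhdsWithin 0 (Set.Ioi 0),
      l1Norm (a + t • z) = l1Norm a + t * l1Dir 1 a z := by
  have key : ∀ i, ∀ᶠ t : ℝ in nhdsWithin 0 (Set.Ioi 0),
      |a i + t * z i| =
        |a i| + t * (if a i = 0 then 1 * |z i| else Real.sign (a i) * z i) := by
    intro i
    by_cases h : a i = 0
    · filter_upwards [self_mem_nhdsWithin] with t (ht : 0 < t)
      simp [h, abs_mul, abs_of_pos ht]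
    · have hlim : Filter.Tendsto (fun t : ℝ => |t * z i|) (nhds 0) (nhds 0) := by
        have : Continuous fun t : ℝ => |t * z i| := by fun_prop
        simpa using this.tendsto 0
      filter_upwards [nhdsWithin_le_nhds (hlim.eventually_lt_const (abs_pos.2 h))] with t ht
      rw [abs_add_eq_of_abs_lt ht, if_neg h]
      ring
  filter_upwards [Filter.eventually_all.2 key] with t ht
  unfold l1Norm l1Dir
  rw [Finset.mul_sum, ← Finset.sum_add_distrib]
  exact Finset.sum_congr rfl fun i _ => ht i

theorem continuous_l1Dir {p : ℕ} (c : ℝ) (a : Fin p → ℝ) : Continuous (l1Dir c a) := by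
  unfold l1Dir
  refine continuous_finsetSum _ fun i _ => ?_
  split_ifs <;> fun_prop

theorem l1Dir_smul {p : ℕ} (c : ℝ) (a z : Fin p → ℝ) {t : ℝ} (ht : 0 < t) :
    l1Dir c a (t • z) = t * l1Dir c a z := by
  unfold l1Dir
  rw [Finset.mul_sum]
  refine Finset.sum_congr rfl fun i _ => ?_
  split_ifs
  · rw [Pi.smul_apply, smul_eq_mul, abs_mul, abs_of_pos ht]
    ring
  · rw [Pi.smul_apply, smul_eq_mul]
    ring

theorem l1Dir_add_le {p : ℕ} {c : ℝ} (hc : 0 ≤ c) (a y z : Fin p → ℝ) :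
    l1Dir c a (y + z) ≤ l1Dir c a y + l1Dir c a z := by
  unfold l1Dir
  rw [← Finset.sum_add_distrib]
  refine Finset.sum_le_sum fun i _ => ?_
  split_ifs
  · rw [← mul_add]
    exact mul_le_mul_of_nonneg_left (abs_add_le _ _) hc
  · rw [Pi.add_apply, mul_add]

theorem l1Dir_single {p : ℕ} (c : ℝ) (a : Fin p → ℝ) (i : Fin p) (t : ℝ) :
    l1Dir c a (Pi.single i t) = if a i = 0 then c * |t| else Real.sign (a i) * t := by
  unfold l1Dir
  rw [Finset.sum_eq_single i]
  · simp
  · intro j _ hj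
    simp [Pi.single_eq_of_ne hj]
  · simp

theorem l1Dir_sub_le {p : ℕ} {ε : ℝ} (hε : 0 ≤ ε) (a z : Fin p → ℝ) :
    l1Dir 1 a z - ε * l1Norm z ≤ l1Dir (1 - ε) a z := by
  unfold l1Dir l1Norm
  rw [Finset.mul_sum, ← Finset.sum_sub_distrib]
  refine Finset.sum_le_sum fun i _ => ?_
  split_ifs
  · linarith
  · linarith [mul_nonneg hε (abs_nonneg (z i))]

theorem euclNorm_eq_zero {n : ℕ} {x : Fin n → ℝ} : euclNorm x = 0 ↔ x = 0 := by
  unfold euclNorm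
  rw [norm_eq_zero, WithLp.toLp_eq_zero]

theorem euclNorm_pos {n : ℕ} {x : Fin n → ℝ} (hx : x ≠ 0) : 0 < euclNorm x :=
  lt_of_le_of_ne (norm_nonneg _) fun h => hx (euclNorm_eq_zero.1 h.symm)

theorem euclNorm_smul {n : ℕ} (t : ℝ) (x : Fin n → ℝ) :
    euclNorm (t • x) = |t| * euclNorm x := by
  unfold euclNorm
  rw [WithLp.toLp_smul, norm_smul, Real.norm_eq_abs]

/-- The directional derivative of the objective at `x₀` is positive along all nonzero feasible
directions. -/
def PositiveDirections {m n p : ℕ} (A : Matrix (Fin m) (Fin n) ℝ) (D : Matrix (Fin n) (Fin p) ℝ)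
    (x₀ : Fin n → ℝ) : Prop :=
  ∀ w, A *ᵥ w = 0 → w ≠ 0 → 0 < l1Dir 1 (Dᵀ *ᵥ x₀) (Dᵀ *ᵥ w)

section

variable {m n p : ℕ} {A : Matrix (Fin m) (Fin n) ℝ} {D : Matrix (Fin n) (Fin p) ℝ}
  {b₀ : Fin m → ℝ} {x₀ : Fin n → ℝ}

theorem isCompact_unit_ker (A : Matrix (Fin m) (Fin n) ℝ) :
    IsCompact {w : Fin n → ℝ | euclNorm w = 1 ∧ A *ᵥ w = 0} := by
  have hc : Continuous fun w : EuclideanSpace ℝ (Fin n) => A *ᵥ w.ofLp := by fun_prop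
  have hK := (isCompact_sphere (0 : EuclideanSpace ℝ (Fin n)) 1).inter_right
    (isClosed_singleton (x := (0 : Fin m → ℝ)) |>.preimage hc)
  convert hK.image (PiLp.continuous_ofLp 2 fun _ : Fin n => ℝ) using 1
  ext w
  constructor
  · rintro ⟨h1, h2⟩
    exact ⟨WithLp.toLp 2 w, ⟨mem_sphere_zero_iff_norm.2 h1, h2⟩, rfl⟩
  · rintro ⟨v, ⟨h1, h2⟩, rfl⟩
    exact ⟨mem_sphere_zero_iff_norm.1 h1, h2⟩

/-- Quantitative form of `PositiveDirections`, uniform under a small shrinking of the box. -/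
theorem PositiveDirections.exists_bound (h : PositiveDirections A D x₀) :
    ∃ κ > 0, (∀ w, A *ᵥ w = 0 → κ * euclNorm w ≤ l1Dir 1 (Dᵀ *ᵥ x₀) (Dᵀ *ᵥ w)) ∧
      ∃ K > 0, ∀ w, A *ᵥ w = 0 → l1Norm (Dᵀ *ᵥ w) ≤ K * euclNorm w := by
  have hK := isCompact_unit_ker A
  have hD : Continuous fun w : Fin n → ℝ => Dᵀ *ᵥ w := by fun_prop
  have hc1 := (continuous_l1Dir 1 (Dᵀ *ᵥ x₀)).comp hD
  have hN : Continuous (l1Norm (p := p)) := by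
    unfold l1Norm
    fun_prop
  have hc2 := hN.comp hD
  have unit : ∀ w, A *ᵥ w = 0 → w ≠ 0 →
      (euclNorm w)⁻¹ • w ∈ {w : Fin n → ℝ | euclNorm w = 1 ∧ A *ᵥ w = 0} := by
    intro w hw hw0
    have hp := euclNorm_pos hw0
    refine ⟨?_, ?_⟩
    · rw [euclNorm_smul, abs_of_pos (inv_pos.2 hp), inv_mul_cancel₀ hp.ne']
    · rw [Matrix.mulVec_smul, hw, smul_zero]
  have scale : ∀ w : Fin n → ℝ, w ≠ 0 → w = euclNorm w • ((euclNorm w)⁻¹ • w) := by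
    intro w hw0
    rw [smul_smul, mul_inv_cancel₀ (euclNorm_pos hw0).ne', one_smul]
  have zero1 : l1Dir 1 (Dᵀ *ᵥ x₀) 0 = 0 := by simp [l1Dir]
  obtain ⟨κ, hκ, hκb⟩ : ∃ κ > 0, ∀ w ∈ {w : Fin n → ℝ | euclNorm w = 1 ∧ A *ᵥ w = 0},
      κ ≤ l1Dir 1 (Dᵀ *ᵥ x₀) (Dᵀ *ᵥ w) := by
    rcases Set.eq_empty_or_nonempty {w : Fin n → ℝ | euclNorm w = 1 ∧ A *ᵥ w = 0} with he | hne
    · exact ⟨1, one_pos, fun w hw => by rw [he] at hw; exact hw.elim⟩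
    · obtain ⟨v, hv, hmin⟩ := hK.exists_isMinOn hne hc1.continuousOn
      refine ⟨_, h v hv.2 ?_, fun w hw => hmin hw⟩
      rintro rfl
      exact zero_ne_one ((euclNorm_eq_zero.2 rfl).symm.trans hv.1)
  obtain ⟨K, hKb⟩ := hK.bddAbove_image hc2.continuousOn
  refine ⟨κ, hκ, fun w hw => ?_, max K 1, lt_max_of_lt_right one_pos, fun w hw => ?_⟩
  · by_cases hw0 : w = 0
    · simp [hw0, zero1, euclNorm_eq_zero.2]
    · have := hκb _ (unit w hw hw0)
      conv_rhs => rw [scale w hw0, Matrix.mulVec_smul, l1Dir_smul _ _ _ (euclNorm_pos hw0)]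
      rw [mul_comm]
      exact mul_le_mul_of_nonneg_left this (norm_nonneg _)
  · by_cases hw0 : w = 0
    · simp [hw0, l1Norm, euclNorm_eq_zero.2]
    · have h1 : l1Norm (Dᵀ *ᵥ ((euclNorm w)⁻¹ • w)) ≤ K := hKb ⟨_, unit w hw hw0, rfl⟩
      have h2 : l1Norm (Dᵀ *ᵥ w) = euclNorm w * l1Norm (Dᵀ *ᵥ ((euclNorm w)⁻¹ • w)) := by
        conv_lhs => rw [scale w hw0, Matrix.mulVec_smul]
        simp only [l1Norm, Pi.smul_apply, smul_eq_mul, abs_mul, Finset.mul_sum,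
          abs_of_pos (euclNorm_pos hw0)]
      rw [h2, mul_comm]
      exact mul_le_mul_of_nonneg_right (h1.trans (le_max_left _ _)) (norm_nonneg _)

theorem exists_transpose_mulVec_eq (A : Matrix (Fin m) (Fin n) ℝ) (v : Fin n → ℝ)
    (h : ∀ w, A *ᵥ w = 0 → v ⬝ᵥ w = 0) : ∃ y, Aᵀ *ᵥ y = v := by
  have hmem : dotProductBilin ℝ ℝ v ∈
      Submodule.span ℝ (Set.range fun i => dotProductBilin ℝ ℝ (A i)) := by
    refine mem_span_of_iInf_ker_le_ker fun w hw => ?_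
    rw [Submodule.mem_iInf] at hw
    exact h w (funext fun i => hw i)
  obtain ⟨y, hy⟩ := (Submodule.mem_span_range_iff_exists_fun ℝ).1 hmem
  refine ⟨y, funext fun j => ?_⟩
  have := LinearMap.congr_fun hy (Pi.single j 1)
  simp only [LinearMap.sum_apply, LinearMap.smul_apply, dotProductBilin_apply_apply,
    dotProduct_single, mul_one, smul_eq_mul] at this
  rw [← this]
  simp [Matrix.mulVec, dotProduct, mul_comm]

theorem exists_sign_vector {p : ℕ} {c : ℝ} (hc : 0 ≤ c) (a : Fin p → ℝ)
    (V : Submodule ℝ (Fin p → ℝ)) (hV : ∀ z ∈ V, 0 ≤ l1Dir c a z) :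
    ∃ u : Fin p → ℝ, (∀ z ∈ V, u ⬝ᵥ z = 0) ∧ (∀ i, a i ≠ 0 → u i = Real.sign (a i)) ∧
      ∀ i, a i = 0 → |u i| ≤ c := by
  obtain ⟨g, hg0, hg⟩ := exists_extension_of_le_sublinear
    (⟨V, 0⟩ : (Fin p → ℝ) →ₗ.[ℝ] ℝ) (l1Dir c a) (fun t ht z => l1Dir_smul c a z ht)
    (l1Dir_add_le hc a) (fun z => hV z z.2)
  have hle : ∀ i t, t * g (Pi.single i 1) ≤
      if a i = 0 then c * |t| else Real.sign (a i) * t := by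
    intro i t
    have := hg (Pi.single i t)
    rwa [l1Dir_single, show (Pi.single i t : Fin p → ℝ) = t • Pi.single i 1 by
      rw [← Pi.single_smul, smul_eq_mul, mul_one], map_smul, smul_eq_mul] at this
  refine ⟨fun i => g (Pi.single i 1), fun z hz => ?_, fun i hi => ?_, fun i hi => ?_⟩
  · have h1 : g z = 0 := hg0 ⟨z, hz⟩
    rw [← h1]
    conv_rhs => rw [LinearMap.pi_apply_eq_sum_univ g z]
    refine Finset.sum_congr rfl fun i _ => ?_
    have hi : (fun j => if i = j then (1 : ℝ) else 0) = Pi.single i 1 := by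
      ext j
      simp [Pi.single_apply, eq_comm]
    rw [hi, smul_eq_mul, mul_comm]
  · have h1 := hle i 1
    have h2 := hle i (-1)
    rw [if_neg hi] at h1 h2
    dsimp only
    linarith
  · have h1 := hle i 1
    have h2 := hle i (-1)
    rw [if_pos hi] at h1 h2
    rw [abs_neg, abs_one] at h2
    rw [abs_one] at h1
    exact abs_le.2 ⟨by linarith, by linarith⟩

theorem PositiveDirections.kernelCondition (h : PositiveDirections A D x₀) :
    KernelCondition A D x₀ := by
  refine (Submodule.eq_bot_iff _).2 fun w hw => ?_
  obtain ⟨hA, hD⟩ := Submodule.mem_inf.1 hw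
  replace hA : A *ᵥ w = 0 := hA
  have hD0 : ∀ i, (Dᵀ *ᵥ x₀) i = 0 → (Dᵀ *ᵥ w) i = 0 := fun i hi =>
    congrFun (LinearMap.mem_ker.1 hD) ⟨i, fun hne => hne hi⟩
  by_contra hw0
  have h1 := h w hA hw0
  have h2 := h (-w) (by rw [Matrix.mulVec_neg, hA, neg_zero]) (neg_ne_zero.2 hw0)
  have h3 : l1Dir 1 (Dᵀ *ᵥ x₀) (Dᵀ *ᵥ (-w)) = -l1Dir 1 (Dᵀ *ᵥ x₀) (Dᵀ *ᵥ w) := by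
    unfold l1Dir
    rw [← Finset.sum_neg_distrib]
    refine Finset.sum_congr rfl fun i _ => ?_
    rw [Matrix.mulVec_neg, Pi.neg_apply]
    split_ifs with hi
    · simp [hD0 i hi]
    · ring
  linarith

theorem PositiveDirections.dualCertificate (h : PositiveDirections A D x₀) :
    DualCertificate A D x₀ := by
  classical
  obtain ⟨κ, hκ, hκb, K, hK, hKb⟩ := h.exists_bound
  have hs : 0 < K + κ := by positivity
  have hε : 0 < κ / (K + κ) := by positivity
  have hε1 : κ / (K + κ) ≤ 1 := (div_le_one hs).2 (by linarith)
  have hεK : κ / (K + κ) * K ≤ κ := by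
    rw [div_mul_eq_mul_div, div_le_iff₀ hs]
    nlinarith
  obtain ⟨u, hu0, huI, huJ⟩ := exists_sign_vector (c := 1 - κ / (K + κ)) (by linarith)
    (Dᵀ *ᵥ x₀) ((LinearMap.ker A.mulVecLin).map Dᵀ.mulVecLin) (by
      rintro _ ⟨w, hw, rfl⟩
      have hw' : A *ᵥ w = 0 := hw
      refine le_trans ?_ (l1Dir_sub_le hε.le _ _)
      have h1 := hκb w hw'
      have h2 := mul_le_mul_of_nonneg_left (hKb w hw') hε.le
      have h3 := mul_le_mul_of_nonneg_right hεK (norm_nonneg (WithLp.toLp 2 w))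
      change _ * euclNorm w ≤ _ * euclNorm w at h3
      rw [Matrix.mulVecLin_apply]
      linarith)
  obtain ⟨y, hy⟩ := exists_transpose_mulVec_eq A (D *ᵥ u) fun w hw => by
    rw [← hu0 _ ⟨w, hw, rfl⟩, Matrix.mulVecLin_apply, Matrix.dotProduct_mulVec,
      Matrix.vecMul_transpose]
  refine ⟨y, u, hy, huI, (pi_norm_lt_iff one_pos).2 fun i => ?_⟩
  exact (huJ i (not_not.1 i.2)).trans_lt (by linarith)

theorem positiveDirections_of_dualCertificate (hk : KernelCondition A D x₀)
    (hd : DualCertificate A D x₀) : PositiveDirections A D x₀ := by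
  classical
  obtain ⟨y, u, hyu, hI, hJ⟩ := hd
  intro w hw hw0
  have hJ' : ∀ i, (Dᵀ *ᵥ x₀) i = 0 → |u i| < 1 := fun i hi =>
    (pi_norm_lt_iff one_pos).1 hJ ⟨i, fun hne => hne hi⟩
  have horth : u ⬝ᵥ (Dᵀ *ᵥ w) = 0 := by
    rw [Matrix.dotProduct_mulVec, Matrix.vecMul_transpose, ← hyu, ← Matrix.vecMul_transpose,
      Matrix.transpose_transpose, ← Matrix.dotProduct_mulVec, hw, dotProduct_zero]
  have hterm : ∀ i, u i * (Dᵀ *ᵥ w) i ≤ if (Dᵀ *ᵥ x₀) i = 0 then 1 * |(Dᵀ *ᵥ w) i|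
      else Real.sign ((Dᵀ *ᵥ x₀) i) * (Dᵀ *ᵥ w) i := by
    intro i
    split_ifs with hi
    · refine (le_abs_self _).trans ?_
      rw [abs_mul]
      exact mul_le_mul_of_nonneg_right (hJ' i hi).le (abs_nonneg _)
    · rw [hI i hi]
  obtain ⟨i, hi, hne⟩ : ∃ i, (Dᵀ *ᵥ x₀) i = 0 ∧ (Dᵀ *ᵥ w) i ≠ 0 := by
    by_contra! hall
    refine hw0 ((Submodule.eq_bot_iff _).1 hk w (Submodule.mem_inf.2 ⟨hw, ?_⟩))
    exact LinearMap.mem_ker.2 (funext fun i => hall i (not_not.1 i.2))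
  rw [← horth]
  refine Finset.sum_lt_sum (fun i _ => hterm i) ⟨i, Finset.mem_univ i, ?_⟩
  rw [if_pos hi]
  refine (le_abs_self _).trans_lt ?_
  rw [abs_mul]
  exact mul_lt_mul_of_pos_right (hJ' i hi) (abs_pos.2 hne)

theorem positiveDirections_iff :
    PositiveDirections A D x₀ ↔ KernelCondition A D x₀ ∧ DualCertificate A D x₀ :=
  ⟨fun h => ⟨h.kernelCondition, h.dualCertificate⟩,
    fun h => positiveDirections_of_dualCertificate h.1 h.2⟩

theorem analysisL1_add_le (D : Matrix (Fin n) (Fin p) ℝ) (x₀ x : Fin n → ℝ) :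
    analysisL1 D x₀ + l1Dir 1 (Dᵀ *ᵥ x₀) (Dᵀ *ᵥ (x - x₀)) ≤ analysisL1 D x := by
  have := l1Norm_add_l1Dir_le (Dᵀ *ᵥ x₀) (Dᵀ *ᵥ (x - x₀))
  rwa [← Matrix.mulVec_add, add_sub_cancel] at this

theorem mulVec_sub_eq_zero {x : Fin n → ℝ} (hx₀ : x₀ ∈ feasibleSet A b₀)
    (hx : x ∈ feasibleSet A b₀) : A *ᵥ (x - x₀) = 0 := by
  rw [Matrix.mulVec_sub, show A *ᵥ x = b₀ from hx, show A *ᵥ x₀ = b₀ from hx₀, sub_self]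

theorem add_smul_mem_feasibleSet {w : Fin n → ℝ} (hx₀ : x₀ ∈ feasibleSet A b₀)
    (hw : A *ᵥ w = 0) (t : ℝ) : x₀ + t • w ∈ feasibleSet A b₀ := by
  change A *ᵥ (x₀ + t • w) = b₀
  rw [Matrix.mulVec_add, Matrix.mulVec_smul, hw, smul_zero, add_zero]
  exact hx₀

theorem eventually_analysisL1_add_smul (D : Matrix (Fin n) (Fin p) ℝ) (x₀ w : Fin n → ℝ) :
    ∀ᶠ t : ℝ in nhdsWithin 0 (Set.Ioi 0), analysisL1 D (x₀ + t • w) =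
      analysisL1 D x₀ + t * l1Dir 1 (Dᵀ *ᵥ x₀) (Dᵀ *ᵥ w) := by
  filter_upwards [eventually_l1Norm_add_smul (Dᵀ *ᵥ x₀) (Dᵀ *ᵥ w)] with t ht
  rwa [← Matrix.mulVec_smul, ← Matrix.mulVec_add] at ht

theorem isUniqueSolution_iff_positiveDirections (hx₀ : x₀ ∈ feasibleSet A b₀) :
    IsUniqueSolution (analysisL1 D) (feasibleSet A b₀) x₀ ↔ PositiveDirections A D x₀ := by
  constructor
  · intro h w hw hw0
    have hsol : x₀ ∈ solutionSet (analysisL1 D) (feasibleSet A b₀) := by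
      rw [show solutionSet _ _ = _ from h]
      exact Set.mem_singleton _
    obtain ⟨t, ht, htpos⟩ := ((eventually_analysisL1_add_smul D x₀ w).and
      self_mem_nhdsWithin).exists
    replace htpos : 0 < t := htpos
    by_contra! hle
    have hmem : x₀ + t • w ∈ solutionSet (analysisL1 D) (feasibleSet A b₀) := by
      refine ⟨add_smul_mem_feasibleSet hx₀ hw t, fun x hx => le_trans ?_ (hsol.2 x hx)⟩
      rw [ht]
      linarith [mul_nonpos_of_nonneg_of_nonpos htpos.le hle]
    rw [show solutionSet _ _ = _ from h, Set.mem_singleton_iff, add_eq_left] at hmem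
    exact (smul_ne_zero htpos.ne' hw0) hmem
  · intro h
    have hlt : ∀ x ∈ feasibleSet A b₀, x ≠ x₀ → analysisL1 D x₀ < analysisL1 D x := by
      intro x hx hne
      have h1 := h (x - x₀) (mulVec_sub_eq_zero hx₀ hx) (sub_ne_zero.2 hne)
      linarith [analysisL1_add_le D x₀ x]
    refine Set.eq_singleton_iff_unique_mem.2 ⟨⟨hx₀, fun x hx => ?_⟩, fun x hx => ?_⟩
    · by_cases hne : x = x₀
      · rw [hne]
      · exact (hlt x hx hne).le
    · by_contra hne
      exact absurd (hx.2 x₀ hx₀) (not_le.2 (hlt x hx.1 hne))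

theorem isSharpSolution_iff_positiveDirections (hx₀ : x₀ ∈ feasibleSet A b₀) :
    IsSharpSolution (analysisL1 D) (feasibleSet A b₀) x₀ ↔ PositiveDirections A D x₀ := by
  constructor
  · rintro ⟨-, κ, hκ, δ, hδ, h⟩ w hw hw0
    have hlim : Filter.Tendsto (fun t : ℝ => |t| * euclNorm w) (nhds 0) (nhds 0) := by
      have : Continuous fun t : ℝ => |t| * euclNorm w := by fun_prop
      simpa using this.tendsto 0
    obtain ⟨t, ⟨ht, htpos⟩, htδ⟩ := (((eventually_analysisL1_add_smul D x₀ w).and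
      self_mem_nhdsWithin).and
        (nhdsWithin_le_nhds (hlim.eventually_lt_const hδ))).exists
    replace htpos : 0 < t := htpos
    have h1 := h _ (add_smul_mem_feasibleSet hx₀ hw t)
      (by rw [add_sub_cancel_left, euclNorm_smul]; exact htδ.le)
    rw [add_sub_cancel_left, euclNorm_smul, abs_of_pos htpos, ht] at h1
    have h2 : 0 < κ * (t * euclNorm w) := mul_pos hκ (mul_pos htpos (euclNorm_pos hw0))
    exact pos_of_mul_pos_right (by linarith) htpos.le
  · intro h
    obtain ⟨κ, hκ, hb, -⟩ := h.exists_bound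
    refine ⟨hx₀, κ, hκ, 1, one_pos, fun x hx _ => ?_⟩
    linarith [hb _ (mulVec_sub_eq_zero hx₀ hx), analysisL1_add_le D x₀ x]

end

theorem mainTheorem10 {m n p : ℕ} (A : Matrix (Fin m) (Fin n) ℝ) (D : Matrix (Fin n) (Fin p) ℝ)
    (b₀ : Fin m → ℝ) (x₀ : Fin n → ℝ) (hx₀ : x₀ ∈ feasibleSet A b₀) :
    (IsUniqueSolution (analysisL1 D) (feasibleSet A b₀) x₀ ↔
      KernelCondition A D x₀ ∧ DualCertificate A D x₀) ∧
    (IsSharpSolution (analysisL1 D) (feasibleSet A b₀) x₀ ↔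
      KernelCondition A D x₀ ∧ DualCertificate A D x₀) :=
  ⟨(isUniqueSolution_iff_positiveDirections hx₀).trans positiveDirections_iff,
    (isSharpSolution_iff_positiveDirections hx₀).trans positiveDirections_iff⟩
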